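/- **Setting.** Let $\mathcal K\subseteq\mathbb R^d$ be convex with $0\in\mathcal K\subseteq R\mathcal B$, where $R\mathcal B$ is the Euclidean ball of radius $R$ about the origin; put $D=2R$. Let $f_1,\dots,f_T:\mathcal K\to[0,1]$ be losses that are $G$-Lipschitz over $\mathcal K$ and convex, in the sense that $f_t(y)\ge f_t(x)+\nabla f_t(x)^\top(y-x)$ for all $x,y\in\mathcal K$. Here $\nabla f_t(x)$ is the gradient of $f_t$ as a function on $\mathcal K$ (a vector of the linear span of $\mathcal K$); more generally, at any point $x$ it may be any vector of norm at most $G$ that satisfies this inequality. An *infeasible projection oracle* $\mathcal O_{\rm IP}$ over $\mathcal K$ maps a tolerance $\epsilon>0$ and a pair $(x_0,y_0)\in\mathcal K\times\mathbb R^d$ to a pair $(x,\tilde y)\in\mathcal K\times R\mathcal B$ with $\|x-\tilde y\|_2\le\sqrt{3\epsilon}$ and $\|\tilde y-z\|_2\le\|y_0-z\|_2$ for all $z\in\mathcal K$. **Expert algorithm $\mathrm{BOGD}_{\rm IP}$ with step size $\eta$, started in round $a$.** Let $B$ be $\eta^{-2/3}$ rounded up or down to an integer, and $\epsilon=\eta^{2/3}$.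 Choose an arbitrary $x_1\in\mathcal K$ and set $\tilde y_1=x_1$. Play $x_m$ in all rounds of block $m$, which consists of the rounds $a+(m-1)B,\dots,a+mB-1$. At the end of the block set $y_{m+1}=\tilde y_m-\eta\sum_{r}\nabla f_r(x_m)$, where $r$ runs over the rounds of block $m$, and $(x_{m+1},\tilde y_{m+1})=\mathcal O_{\rm IP}(\mathcal K,\epsilon,x_m,y_{m+1})$. **POLA.** Let $\mathcal I$ be the set of all geometric covering intervals $[i2^k,(i+1)2^k-1]$, with integers $k\ge0$ and $i\ge1$. On each $I\in\mathcal I$ run an expert $E_I$, that is, $\mathrm{BOGD}_{\rm IP}$ with $\eta=|I|^{-3/4}$ started in round $\min I$; let $x_{t,I}$ be its action in round $t\in I$. Let $$\Phi(R,C)=\exp\!\Big(\frac{[R]_+^2}{3C}\Big),\quad \Phi(0,0)=1,\qquad w(R,C)=\tfrac12\big(\Phi(R+1,C+1)-\Phi(R-1,C+1)\big),$$ $$R_{t-1,I}=\sum_{u=\min I}^{t-1}\big(f_u(x_u)-f_u(x_{u,I})\big),\qquad C_{t-1,I}=\sum_{u=\min I}^{t-1}\big|f_u(x_u)-f_u(x_{u,I})\big|.$$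 In round $t=1,\dots,T$, POLA plays $$x_t=\sum_{I\in\mathcal I:\,t\in I}w_{t,I}\,x_{t,I},\qquad w_{t,I}=\frac{w(R_{t-1,I},C_{t-1,I})}{\sum_{J\in\mathcal I:\,t\in J}w(R_{t-1,J},C_{t-1,J})}.$$ **Theorem.** There is a constant $c$ that depends only on $R$ and $G$ such that, for all $d$, $\mathcal K$, $\mathcal O_{\rm IP}$, $T$, losses, initial points and roundings of the block sizes as above, and for every $1\le\tau\le T$, the strongly adaptive regret $$\text{SA-Regret}_T(\tau)=\max_{[s,s+\tau-1]\subseteq[1,T]}\Big\{\sum_{t=s}^{s+\tau-1}f_t(x_t)-\inf_{x\in\mathcal K}\sum_{t=s}^{s+\tau-1}f_t(x)\Big\}$$ of POLA satisfies $$\text{SA-Regret}_T(\tau)\le c\big(\sqrt{\tau\log T}+\tau^{3/4}\big)\qquad\text{and}\qquad \text{SA-Regret}_T(\tau)\le c\,\sqrt{1+\log T}\;\tau^{3/4},$$ i.e. it is $O(\sqrt{\tau\log T}+\tau^{3/4})=\tilde O(\tau^{3/4})$. -/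

import Mathlib

noncomputable section

namespace POLA

/-! ### Geometric covering intervals -/

/-- The geometric covering interval `[i * 2 ^ k, (i + 1) * 2 ^ k - 1]`, where `k ≥ 0` and `i ≥ 1`. -/
structure GCInterval where
  k : ℕ
  i : ℕ
  one_le_i : 1 ≤ i

namespace GCInterval

/-- First round of the interval. -/
def start (I : GCInterval) : ℕ := I.i * 2 ^ I.k

/-- Last round of the interval. -/
def last (I : GCInterval) : ℕ := (I.i + 1) * 2 ^ I.k - 1

/-- The set of rounds of the interval. -/
def rounds (I : GCInterval) : Finset ℕ := Finset.Icc I.start I.last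

/-- The length `|I|`. -/
def length (I : GCInterval) : ℕ := I.rounds.card

theorem length_eq (I : GCInterval) : I.length = 2 ^ I.k := by
  have h : 0 < 2 ^ I.k := by positivity
  simp only [length, rounds, start, last, Nat.card_Icc, Nat.add_mul, one_mul]
  omega

/-- Only finitely many geometric covering intervals contain a given round. -/
theorem finite_setOf_mem_rounds (t : ℕ) : {I : GCInterval | t ∈ I.rounds}.Finite := by
  have hinj : Function.Injective (fun I : GCInterval => (I.k, I.i)) := by
    rintro ⟨k, i, h⟩ ⟨k', i', h'⟩ hh
    simp only [Prod.mk.injEq] at hh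
    obtain ⟨rfl, rfl⟩ := hh
    rfl
  refine Set.Finite.of_finite_image (f := fun I : GCInterval => (I.k, I.i)) ?_ hinj.injOn
  refine ((Set.finite_Iic t).prod (Set.finite_Iic t)).subset ?_
  rintro _ ⟨I, hI, rfl⟩
  simp only [Set.mem_ofPred_eq, rounds, Finset.mem_Icc, start] at hI
  have h1 : I.k < 2 ^ I.k := Nat.lt_two_pow_self
  have h2 := I.one_le_i
  constructor
  · simp only [Set.mem_Iic]
    nlinarith
  · simp only [Set.mem_Iic]
    nlinarith

end GCInterval

/-- The set of experts that are active in round `t`: one expert for each geometric covering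
interval that contains `t`. -/
def active (t : ℕ) : Finset GCInterval := (GCInterval.finite_setOf_mem_rounds t).toFinset

theorem mem_active {t : ℕ} {I : GCInterval} : I ∈ active t ↔ t ∈ I.rounds := by
  simp [active]

/-! ### Gradients of the losses -/

/-- `v` is admissible as the gradient at `x` of a loss `h` that is `G`-Lipschitz over `K` (a set
that contains the origin). Either it is the gradient of `h` as a function on `K`, which is a vector
of the linear span of `K` (if `K` has interior points, the span is the whole space, and this is the
usual gradient), or it is any vector of norm at most `G`. The first-order inequality
`h y ≥ h x + ⟪v, y - x⟫` is not part of this definition. -/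
def IsLossGradient {d : ℕ} (K : Set (EuclideanSpace ℝ (Fin d))) (G : ℝ)
    (h : EuclideanSpace ℝ (Fin d) → ℝ) (x v : EuclideanSpace ℝ (Fin d)) : Prop :=
  (HasGradientWithinAt h v K x ∧ v ∈ Submodule.span ℝ K) ∨ ‖v‖ ≤ G

/-! ### Blocked online gradient descent with infeasible projections -/

/-- `(x, y)` is a legitimate answer of an infeasible projection oracle over `K ⊆ R𝓑` with error
tolerance `ε` to the input `y₀`. -/
structure IsInfeasibleProjection {d : ℕ} (K : Set (EuclideanSpace ℝ (Fin d))) (R ε : ℝ)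
    (y₀ x y : EuclideanSpace ℝ (Fin d)) : Prop where
  feasible : x ∈ K
  bounded : y ∈ Metric.closedBall (0 : EuclideanSpace ℝ (Fin d)) R
  close : ‖x - y‖ ≤ Real.sqrt (3 * ε)
  pull : ∀ z ∈ K, ‖y - z‖ ≤ ‖y₀ - z‖

/-- `B` is the real number `η ^ (-2/3)` rounded, up or down, to an integer. -/
def IsBlockSize (η : ℝ) (B : ℕ) : Prop :=
  B = ⌊η ^ (-(2 / 3) : ℝ)⌋₊ ∨ B = ⌈η ^ (-(2 / 3) : ℝ)⌉₊

/-- An oracle for the infeasible projections over `K ⊆ R𝓑`: it maps a tolerance `ε` and an input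
`(x₀, y₀)` to an answer `(x, y)`. -/
def IsInfeasibleProjectionOracle {d : ℕ} (K : Set (EuclideanSpace ℝ (Fin d))) (R : ℝ)
    (O : ℝ → EuclideanSpace ℝ (Fin d) → EuclideanSpace ℝ (Fin d) →
      EuclideanSpace ℝ (Fin d) × EuclideanSpace ℝ (Fin d)) : Prop :=
  ∀ ε : ℝ, 0 < ε → ∀ x₀ ∈ K, ∀ y₀ : EuclideanSpace ℝ (Fin d),
    IsInfeasibleProjection K R ε y₀ (O ε x₀ y₀).1 (O ε x₀ y₀).2

/-- The actions `z t`, for the rounds `a ≤ t ≤ e`, are produced by blocked online gradient descent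
with infeasible projections that is started in round `a` from a point of `K`, with step size `η`,
block size `B`, tolerance `η ^ (2/3)`, and oracle `O`; `g t` is the gradient of the loss of
round `t`. Blocks are counted from `0`: block `m` consists of the rounds
`a + m * B, …, a + (m + 1) * B - 1`, and `X m`, `Y m` are its feasible and infeasible points. -/
def IsBOGDRun {d : ℕ} (K : Set (EuclideanSpace ℝ (Fin d)))
    (O : ℝ → EuclideanSpace ℝ (Fin d) → EuclideanSpace ℝ (Fin d) →
      EuclideanSpace ℝ (Fin d) × EuclideanSpace ℝ (Fin d))
    (g : ℕ → EuclideanSpace ℝ (Fin d) → EuclideanSpace ℝ (Fin d))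
    (η : ℝ) (B a e : ℕ) (z : ℕ → EuclideanSpace ℝ (Fin d)) : Prop :=
  ∃ X Y : ℕ → EuclideanSpace ℝ (Fin d),
    X 0 ∈ K ∧ Y 0 = X 0 ∧
    (∀ t, a ≤ t → t ≤ e → z t = X ((t - a) / B)) ∧
    (∀ m, a + (m + 1) * B ≤ e + 1 →
      (X (m + 1), Y (m + 1)) =
        O (η ^ (2 / 3 : ℝ)) (X m) (Y m - η • ∑ j ∈ Finset.range B, g (a + m * B + j) (X m)))

/-! ### The meta algorithm AdaNormalHedge -/

/-- The potential `exp ([R]₊ ^ 2 / (3 C))`; since `0 / 0 = 0`, its value at `(0, 0)` is `1`. -/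
def potential (R C : ℝ) : ℝ := Real.exp ((max 0 R) ^ 2 / (3 * C))

/-- The weight function of AdaNormalHedge. -/
def weight (R C : ℝ) : ℝ := (potential (R + 1) (C + 1) - potential (R - 1) (C + 1)) / 2

/-- The regret of the learner's actions `x` against the actions `xE · I` of the expert of `I` in the
rounds from the start of `I` to `t - 1`. -/
def cumRegret {d : ℕ} (f : ℕ → EuclideanSpace ℝ (Fin d) → ℝ) (x : ℕ → EuclideanSpace ℝ (Fin d))
    (xE : ℕ → GCInterval → EuclideanSpace ℝ (Fin d)) (t : ℕ) (I : GCInterval) : ℝ :=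
  ∑ u ∈ Finset.Ico I.start t, (f u (x u) - f u (xE u I))

/-- The sum of the absolute values of the instantaneous regrets in the same rounds. -/
def cumAbsRegret {d : ℕ} (f : ℕ → EuclideanSpace ℝ (Fin d) → ℝ)
    (x : ℕ → EuclideanSpace ℝ (Fin d))
    (xE : ℕ → GCInterval → EuclideanSpace ℝ (Fin d)) (t : ℕ) (I : GCInterval) : ℝ :=
  ∑ u ∈ Finset.Ico I.start t, |f u (x u) - f u (xE u I)|

/-- The normalized weight of the expert of `I` in round `t`. -/
def expertWeight {d : ℕ} (f : ℕ → EuclideanSpace ℝ (Fin d) → ℝ)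
    (x : ℕ → EuclideanSpace ℝ (Fin d))
    (xE : ℕ → GCInterval → EuclideanSpace ℝ (Fin d)) (t : ℕ) (I : GCInterval) : ℝ :=
  weight (cumRegret f x xE t I) (cumAbsRegret f x xE t I) /
    ∑ J ∈ active t, weight (cumRegret f x xE t J) (cumAbsRegret f x xE t J)

/-! ### The algorithm and its performance metric -/

/-- `x 1, …, x T` are the actions that POLA submits when it runs for `T` rounds against the losses
`f t` with gradients `g t`; `xE t I` is the action in round `t` of the expert that runs on `I`. -/
structure IsPOLARun {d : ℕ} (K : Set (EuclideanSpace ℝ (Fin d)))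
    (O : ℝ → EuclideanSpace ℝ (Fin d) → EuclideanSpace ℝ (Fin d) →
      EuclideanSpace ℝ (Fin d) × EuclideanSpace ℝ (Fin d))
    (T : ℕ) (f : ℕ → EuclideanSpace ℝ (Fin d) → ℝ)
    (g : ℕ → EuclideanSpace ℝ (Fin d) → EuclideanSpace ℝ (Fin d))
    (xE : ℕ → GCInterval → EuclideanSpace ℝ (Fin d))
    (x : ℕ → EuclideanSpace ℝ (Fin d)) : Prop where
  expert : ∀ I : GCInterval, I.start ≤ T →
    ∃ B : ℕ, IsBlockSize ((I.length : ℝ) ^ (-(3 / 4) : ℝ)) B ∧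
      IsBOGDRun K O g ((I.length : ℝ) ^ (-(3 / 4) : ℝ)) B I.start (min I.last T)
        (fun t => xE t I)
  combine : ∀ t ∈ Finset.Icc 1 T, x t = ∑ I ∈ active t, expertWeight f x xE t I • xE t I

/-- The static regret over the rounds `s, …, s + τ - 1`. -/
def staticRegret {d : ℕ} (K : Set (EuclideanSpace ℝ (Fin d)))
    (f : ℕ → EuclideanSpace ℝ (Fin d) → ℝ) (x : ℕ → EuclideanSpace ℝ (Fin d)) (s τ : ℕ) : ℝ :=
  ∑ t ∈ Finset.Ico s (s + τ), f t (x t) -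
    sInf ((fun z => ∑ t ∈ Finset.Ico s (s + τ), f t z) '' K)

/-- The strongly adaptive regret: the largest static regret over an interval
`[s, s + τ - 1] ⊆ [1, T]`. -/
def saRegret {d : ℕ} (K : Set (EuclideanSpace ℝ (Fin d)))
    (f : ℕ → EuclideanSpace ℝ (Fin d) → ℝ) (x : ℕ → EuclideanSpace ℝ (Fin d)) (T τ : ℕ) : ℝ :=
  sSup {r | ∃ s : ℕ, 1 ≤ s ∧ s + τ ≤ T + 1 ∧ r = staticRegret K f x s τ}

end POLA

end

/-!
The regret of POLA on a geometric covering interval `I` of length `L` against a fixed `u ∈ K` splits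
into the regret against the expert of `I` and the regret of that expert against `u`.

*Experts* (`IsBOGDRun.regret_le`, `expert_regret_le`). The infeasible projection moves the iterate no
farther from any point of `K`, so the usual telescoping of squared distances applies to the
infeasible points; playing the nearby feasible points costs `√(3 ε)` per round. With step size
`L ^ (-3/4)` and blocks of about `L ^ (1/2)` rounds, every term is of order `L ^ (3/4)`. The gradients
are bounded by `|G|` also at boundary points of `K`, since the differences of points of `K` generate
its linear span (`IsLossGradient.norm_le`).

*Meta algorithm* (`cumRegret_le`). Along a segment of admissible regrets the potential is convex, so
that one round reduces to a fair coin flip, which raises it by at most a constant on average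
(`potential_step_le`). The weights make the first-order terms cancel, by convexity of the losses
(`sum_weight_mul_regret_nonpos`). As at most `t` experts are active in round `t`, the total potential
stays polynomial in `T`; hence every expert has regret at most of order `√(L (1 + log T))`.

*Covering* (`sum_Ico_le_of_dyadic`). An arbitrary interval of `τ` rounds is cut at a multiple of the
largest power of two below its length; each side is decomposed into geometric covering intervals
whose bounds form a geometric series dominated by its largest term.
-/

namespace POLA

/-! ### Norms of loss gradients -/

/-- The differences of points of a convex set that contains the origin generate, as a cone, the
whole linear span of the set. -/
theorem exists_smul_sub_of_mem_span {E : Type*} [AddCommGroup E] [Module ℝ E] {K : Set E}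
    (hK : Convex ℝ K) (h0 : (0 : E) ∈ K) {w : E} (hw : w ∈ Submodule.span ℝ K) :
    ∃ t : ℝ, 0 ≤ t ∧ ∃ u ∈ K, ∃ u' ∈ K, w = t • (u - u') := by
  induction hw using Submodule.span_induction with
  | mem x hx => exact ⟨1, zero_le_one, x, hx, 0, h0, by simp⟩
  | zero => exact ⟨0, le_rfl, 0, h0, 0, h0, by simp⟩
  | add x y _ _ hx hy =>
    obtain ⟨t, ht, u, hu, u', hu', rfl⟩ := hx
    obtain ⟨r, hr, v, hv, v', hv', rfl⟩ := hy
    rcases (add_nonneg ht hr).eq_or_lt with h | h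
    · have h1 : t = 0 := by linarith
      have h2 : r = 0 := by linarith
      exact ⟨0, le_rfl, 0, h0, 0, h0, by simp [h1, h2]⟩
    · have hsum : t / (t + r) + r / (t + r) = 1 := by field_simp
      refine ⟨t + r, h.le, (t / (t + r)) • u + (r / (t + r)) • v,
        hK hu hv (by positivity) (by positivity) hsum,
        (t / (t + r)) • u' + (r / (t + r)) • v',
        hK hu' hv' (by positivity) (by positivity) hsum, ?_⟩
      have e1 : (t + r) * (t / (t + r)) = t := by field_simp
      have e2 : (t + r) * (r / (t + r)) = r := by field_simp
      simp only [smul_sub, smul_add, smul_smul, e1, e2]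
      abel
  | smul a x _ hx =>
    obtain ⟨t, ht, u, hu, u', hu', rfl⟩ := hx
    rcases le_total 0 a with h | h
    · exact ⟨a * t, by positivity, u, hu, u', hu', by rw [smul_smul]⟩
    · refine ⟨-a * t, mul_nonneg (by linarith) ht, u', hu', u, hu, ?_⟩
      rw [smul_smul, neg_mul, neg_smul, ← smul_neg, neg_sub]

/-- A gradient on a convex set inherits the Lipschitz constant in every direction that joins two
points of the set, even at boundary points: rescale the two points towards `x`. -/
theorem inner_sub_le_of_hasGradientWithinAt {E : Type*} [NormedAddCommGroup E]
    [InnerProductSpace ℝ E] [CompleteSpace E] {K : Set E} (hK : Convex ℝ K) {G : ℝ} {h : E → ℝ}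
    {x v : E} (hx : x ∈ K) (hL : ∀ u ∈ K, ∀ w ∈ K, |h u - h w| ≤ G * ‖u - w‖)
    (hv : HasGradientWithinAt h v K x) {u u' : E} (hu : u ∈ K) (hu' : u' ∈ K) :
    inner ℝ v (u - u') ≤ G * ‖u - u'‖ := by
  have hmem : ∀ w ∈ K, ∀ s ∈ Set.Ioc (0 : ℝ) 1, x + s • (w - x) ∈ K := fun w hw s hs =>
    hK.add_smul_sub_mem hx hw ⟨hs.1.le, hs.2⟩
  have key : ∀ w ∈ K, HasDerivWithinAt (fun s : ℝ => h (x + s • (w - x))) (inner ℝ v (w - x))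
      (Set.Ioc 0 1) 0 := by
    intro w hw
    have hc : HasDerivWithinAt (fun s : ℝ => x + s • (w - x)) (w - x) (Set.Ioc 0 1) 0 := by
      simpa using (((hasDerivAt_id (0 : ℝ)).smul_const (w - x)).const_add x).hasDerivWithinAt
    have hv' : HasFDerivWithinAt h (InnerProductSpace.toDual ℝ E v) K
        (x + (0 : ℝ) • (w - x)) := by
      simpa using hv.hasFDerivWithinAt
    exact (hv'.comp_hasDerivWithinAt (0 : ℝ) hc (hmem w hw)).congr_deriv (by simp)
  have hd := (key u hu).sub (key u' hu')
  rw [← inner_sub_right, sub_sub_sub_cancel_right,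
    hasDerivWithinAt_iff_tendsto_slope' (by simp), nhdsWithin_Ioc_eq_nhdsGT zero_lt_one] at hd
  refine le_of_tendsto hd ?_
  filter_upwards [Ioc_mem_nhdsGT (zero_lt_one' ℝ)] with s hs
  have h1 := (le_abs_self _).trans (hL _ (hmem u hu s hs) _ (hmem u' hu' s hs))
  have h2 : x + s • (u - x) - (x + s • (u' - x)) = s • (u - u') := by
    simp only [smul_sub]; abel
  rw [h2, norm_smul, Real.norm_of_nonneg hs.1.le] at h1
  simp only [slope_def_field, Pi.sub_apply, zero_smul, add_zero, sub_self, sub_zero]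
  rw [div_le_iff₀ hs.1]
  linarith

theorem IsLossGradient.norm_le {d : ℕ} {K : Set (EuclideanSpace ℝ (Fin d))} (hK : Convex ℝ K)
    (h0 : 0 ∈ K) {G : ℝ} {h : EuclideanSpace ℝ (Fin d) → ℝ} {x v : EuclideanSpace ℝ (Fin d)}
    (hx : x ∈ K) (hL : ∀ u ∈ K, ∀ w ∈ K, |h u - h w| ≤ G * ‖u - w‖)
    (hv : IsLossGradient K G h x v) : ‖v‖ ≤ |G| := by
  rcases hv with ⟨hv, hs⟩ | hv
  · obtain ⟨t, ht, u, hu, u', hu', e⟩ := exists_smul_sub_of_mem_span hK h0 hs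
    have h1 := mul_le_mul_of_nonneg_left
      (inner_sub_le_of_hasGradientWithinAt hK hx hL hv hu hu') ht
    have h2 : ‖v‖ * ‖v‖ ≤ |G| * ‖v‖ := by
      calc ‖v‖ * ‖v‖ = inner ℝ v v := (real_inner_self_eq_norm_mul_norm v).symm
        _ = t * inner ℝ v (u - u') := by
          conv_lhs => rw [e, inner_smul_right, ← e]
        _ ≤ G * ‖v‖ := by
          conv_rhs => rw [e, norm_smul, Real.norm_of_nonneg ht]
          linarith
        _ ≤ |G| * ‖v‖ := mul_le_mul_of_nonneg_right (le_abs_self G) (norm_nonneg v)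
    rcases (norm_nonneg v).eq_or_lt with h | h
    · rw [← h]; exact abs_nonneg G
    · exact le_of_mul_le_mul_right h2 h
  · exact hv.trans (le_abs_self G)

/-! ### Blocked online gradient descent -/

/-- One block of gradient descent: an infeasible projection brings the point no farther from the
comparator `u` than the gradient step does. -/
theorem inner_le_of_infeasible_step {E : Type*} [NormedAddCommGroup E] [InnerProductSpace ℝ E]
    {η δ Γ : ℝ} (hη : 0 < η) {x y y' v u : E} (hv : ‖v‖ ≤ Γ) (hxy : ‖x - y‖ ≤ δ)
    (hy' : ‖y' - u‖ ≤ ‖y - η • v - u‖) :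
    inner ℝ v (x - u) + ‖y' - u‖ ^ 2 / (2 * η) ≤
      ‖y - u‖ ^ 2 / (2 * η) + (η * Γ ^ 2 / 2 + Γ * δ) := by
  have h1 : ‖y' - u‖ ^ 2 ≤ ‖y - u‖ ^ 2 - 2 * η * inner ℝ v (y - u) + η ^ 2 * ‖v‖ ^ 2 := by
    calc ‖y' - u‖ ^ 2 ≤ ‖y - η • v - u‖ ^ 2 := by gcongr
      _ = ‖(y - u) - η • v‖ ^ 2 := by rw [sub_right_comm]
      _ = _ := by
        rw [norm_sub_sq_real, inner_smul_right, norm_smul, Real.norm_of_nonneg hη.le,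
          real_inner_comm]
        ring
  have h2 : inner ℝ v (x - u) = inner ℝ v (y - u) + inner ℝ v (x - y) := by
    rw [← inner_add_right]; congr 1; abel
  have h3 : inner ℝ v (x - y) ≤ Γ * δ :=
    (real_inner_le_norm v (x - y)).trans
      (mul_le_mul hv hxy (norm_nonneg _) ((norm_nonneg _).trans hv))
  have h4 : ‖v‖ ^ 2 ≤ Γ ^ 2 := by gcongr
  have h5 : ‖y' - u‖ ^ 2 / (2 * η) ≤ ‖y - u‖ ^ 2 / (2 * η) - inner ℝ v (y - u) + η * Γ ^ 2 / 2 := by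
    rw [div_le_iff₀ (by positivity)]
    have : (‖y - u‖ ^ 2 / (2 * η) - inner ℝ v (y - u) + η * Γ ^ 2 / 2) * (2 * η) =
        ‖y - u‖ ^ 2 - 2 * η * inner ℝ v (y - u) + η ^ 2 * Γ ^ 2 := by
      field_simp
    rw [this]
    nlinarith [sq_nonneg η]
  linarith

section Expert

variable {d : ℕ} {K : Set (EuclideanSpace ℝ (Fin d))}
  {O : ℝ → EuclideanSpace ℝ (Fin d) → EuclideanSpace ℝ (Fin d) →
    EuclideanSpace ℝ (Fin d) × EuclideanSpace ℝ (Fin d)}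
  {g : ℕ → EuclideanSpace ℝ (Fin d) → EuclideanSpace ℝ (Fin d)}
  {f : ℕ → EuclideanSpace ℝ (Fin d) → ℝ}
  {R η : ℝ} {B a e : ℕ} {z : ℕ → EuclideanSpace ℝ (Fin d)}

theorem IsBOGDRun.mem (hO : IsInfeasibleProjectionOracle K R O) (hη : 0 < η)
    (h : IsBOGDRun K O g η B a e z) {t : ℕ} (hat : a ≤ t) (hte : t ≤ e) : z t ∈ K := by
  obtain ⟨X, Y, hX0, -, hz, hstep⟩ := h
  have hX : ∀ m, a + m * B ≤ e + 1 → X m ∈ K := by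
    intro m
    induction m with
    | zero => exact fun _ => hX0
    | succ m ih =>
      intro hm
      have hXm := ih (by rw [Nat.add_mul] at hm; omega)
      have hp := hO (η ^ (2 / 3 : ℝ)) (by positivity) _ hXm
        (Y m - η • ∑ j ∈ Finset.range B, g (a + m * B + j) (X m))
      rw [← hstep m hm] at hp
      exact hp.feasible
  rw [hz t hat hte]
  exact hX _ (by have := Nat.div_mul_le_self (t - a) B; omega)

/-- Regret of blocked online gradient descent with infeasible projections over all its rounds, for
losses with values in `[0, 1]`. The last summand pays for an incomplete final block. -/
theorem IsBOGDRun.regret_le (hO : IsInfeasibleProjectionOracle K R O) (hη : 0 < η) (hB : 0 < B)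
    (hKR : K ⊆ Metric.closedBall 0 R) {Γ : ℝ} (hΓ : 0 ≤ Γ)
    (hg : ∀ t, a ≤ t → t ≤ e → ∀ p ∈ K, ‖g t p‖ ≤ Γ)
    (hconv : ∀ t, a ≤ t → t ≤ e → ∀ p ∈ K, ∀ q ∈ K, f t p + inner ℝ (g t p) (q - p) ≤ f t q)
    (hf : ∀ t, a ≤ t → t ≤ e → ∀ p ∈ K, 0 ≤ f t p ∧ f t p ≤ 1)
    (h : IsBOGDRun K O g η B a e z) {N : ℕ} (hN : a + N = e + 1)
    {u : EuclideanSpace ℝ (Fin d)} (hu : u ∈ K) :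
    ∑ t ∈ Finset.Ico a (a + N), (f t (z t) - f t u) ≤
      (2 * R) ^ 2 / (2 * η) + N * (η * B * Γ ^ 2 / 2 + Γ * Real.sqrt (3 * η ^ (2 / 3 : ℝ))) + B := by
  have hzK : ∀ t, a ≤ t → t ≤ e → z t ∈ K := fun t h1 h2 => h.mem hO hη h1 h2
  obtain ⟨X, Y, hX0, hY0, hz, hstep⟩ := h
  set δ := Real.sqrt (3 * η ^ (2 / 3 : ℝ)) with hδ
  set φ : ℕ → ℝ := fun i => f (a + i) (z (a + i)) - f (a + i) u with hφ
  have main : ∀ m, m * B ≤ N → X m ∈ K ∧ ‖X m - Y m‖ ≤ δ ∧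
      ∑ i ∈ Finset.range (m * B), φ i + ‖Y m - u‖ ^ 2 / (2 * η) ≤
        ‖X 0 - u‖ ^ 2 / (2 * η) + m * (η * (B * Γ) ^ 2 / 2 + B * Γ * δ) := by
    intro m
    induction m with
    | zero => exact fun _ => ⟨hX0, by simp [hY0, hδ], by simp [hY0]⟩
    | succ m ih =>
      intro hm
      have hmB : (m + 1) * B = m * B + B := by ring
      obtain ⟨hXm, hXY, hreg⟩ := ih (by omega)
      have hp := hO (η ^ (2 / 3 : ℝ)) (by positivity) _ hXm
        (Y m - η • ∑ j ∈ Finset.range B, g (a + m * B + j) (X m))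
      rw [← hstep m (by omega)] at hp
      refine ⟨hp.feasible, hp.close, ?_⟩
      have hv : ‖∑ j ∈ Finset.range B, g (a + m * B + j) (X m)‖ ≤ B * Γ := by
        refine (norm_sum_le_of_le _ (f := fun j => g (a + m * B + j) (X m)) (n := fun _ => Γ)
          fun j hj => ?_).trans (by simp)
        rw [Finset.mem_range] at hj
        exact hg _ (by omega) (by omega) _ hXm
      have hblock := inner_le_of_infeasible_step hη hv hXY (hp.pull u hu)
      have hlin : ∑ j ∈ Finset.range B, φ (m * B + j) ≤
          inner ℝ (∑ j ∈ Finset.range B, g (a + m * B + j) (X m)) (X m - u) := by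
        rw [sum_inner]
        refine Finset.sum_le_sum fun j hj => ?_
        rw [Finset.mem_range] at hj
        have hidx : (a + (m * B + j) - a) / B = m := by
          rw [Nat.add_sub_cancel_left, mul_comm, Nat.mul_add_div hB, Nat.div_eq_of_lt hj, add_zero]
        have hc := hconv (a + m * B + j) (by omega) (by omega) _ hXm u hu
        have hneg : inner ℝ (g (a + m * B + j) (X m)) (u - X m) =
            -inner ℝ (g (a + m * B + j) (X m)) (X m - u) := by
          rw [← inner_neg_right, neg_sub]
        simp only [hφ, hz (a + (m * B + j)) (by omega) (by omega), hidx]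
        rw [← add_assoc]
        linarith
      rw [hmB, Finset.sum_range_add]
      push_cast
      linarith
  obtain ⟨-, -, hreg⟩ := main (N / B) (Nat.div_mul_le_self N B)
  have hM : ((N / B : ℕ) : ℝ) * B ≤ N := by exact_mod_cast Nat.div_mul_le_self N B
  have hrest : ∑ j ∈ Finset.range (N % B), φ (N / B * B + j) ≤ B := by
    have hlt := Nat.mod_lt N hB
    have hdm := Nat.div_add_mod' N B
    calc ∑ j ∈ Finset.range (N % B), φ (N / B * B + j) ≤ ∑ j ∈ Finset.range (N % B), (1 : ℝ) := by
          refine Finset.sum_le_sum fun j hj => ?_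
          rw [Finset.mem_range] at hj
          have h1 : a ≤ a + (N / B * B + j) := by omega
          have h2 : a + (N / B * B + j) ≤ e := by omega
          have h3 := (hf _ h1 h2 _ (hzK _ h1 h2)).2
          have h4 := (hf _ h1 h2 u hu).1
          simp only [hφ]
          linarith
      _ ≤ B := by
          simp only [Finset.sum_const, Finset.card_range, nsmul_eq_mul, mul_one]
          exact_mod_cast hlt.le
  have hsplit : ∑ t ∈ Finset.Ico a (a + N), (f t (z t) - f t u) =
      ∑ i ∈ Finset.range (N / B * B), φ i + ∑ j ∈ Finset.range (N % B), φ (N / B * B + j) := by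
    rw [← Finset.sum_range_add, Nat.div_add_mod', Finset.sum_Ico_eq_sum_range,
      Nat.add_sub_cancel_left]
  have hdiam : ‖X 0 - u‖ ≤ 2 * R := by
    have h1 := hKR hX0
    have h2 := hKR hu
    rw [mem_closedBall_zero_iff] at h1 h2
    linarith [norm_sub_le (X 0) u]
  have hstart : ‖X 0 - u‖ ^ 2 / (2 * η) ≤ (2 * R) ^ 2 / (2 * η) := by gcongr
  have hcoef : ((N / B : ℕ) : ℝ) * (η * (B * Γ) ^ 2 / 2 + B * Γ * δ) ≤
      N * (η * B * Γ ^ 2 / 2 + Γ * δ) := by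
    have hδ0 : 0 ≤ δ := Real.sqrt_nonneg _
    calc ((N / B : ℕ) : ℝ) * (η * (B * Γ) ^ 2 / 2 + B * Γ * δ) =
        ((N / B : ℕ) * B) * (η * B * Γ ^ 2 / 2 + Γ * δ) := by ring
      _ ≤ _ := mul_le_mul_of_nonneg_right hM (by positivity)
  have hlast : 0 ≤ ‖Y (N / B) - u‖ ^ 2 / (2 * η) := by positivity
  rw [hsplit]
  linarith

end Expert

theorem IsBlockSize.bounds {q : ℝ} (hq : 1 ≤ q) {η : ℝ} (hη : η ^ (-(2 / 3) : ℝ) = q ^ 2) {B : ℕ}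
    (hB : IsBlockSize η B) : 1 ≤ B ∧ (B : ℝ) ≤ 2 * q ^ 2 := by
  have hq2 : 1 ≤ q ^ 2 := one_le_pow₀ hq
  rw [IsBlockSize, hη] at hB
  rcases hB with rfl | rfl
  · exact ⟨Nat.le_floor (by simpa using hq2), (Nat.floor_le (by positivity)).trans (by linarith)⟩
  · exact ⟨Nat.one_le_ceil_iff.2 (by positivity), (Nat.ceil_lt_add_one (by positivity)).le.trans
      (by linarith)⟩

/-! ### The potential of AdaNormalHedge -/

theorem potential_pos (R C : ℝ) : 0 < potential R C := Real.exp_pos _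

theorem potential_mono {R R' C : ℝ} (hC : 0 ≤ C) (h : R ≤ R') : potential R C ≤ potential R' C := by
  have h0 : 0 ≤ max 0 R := le_max_left _ _
  have h1 : max 0 R ≤ max 0 R' := max_le_max le_rfl h
  unfold potential
  gcongr

theorem weight_nonneg {R C : ℝ} (hC : 0 ≤ C) : 0 ≤ weight R C := by
  have := potential_mono (R := R - 1) (R' := R + 1) (C := C + 1) (by linarith) (by linarith)
  unfold weight
  linarith

theorem weight_zero_zero_pos : 0 < weight 0 0 := by
  have : (1 : ℝ) < Real.exp (1 / 3) := Real.one_lt_exp_iff.2 (by norm_num)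
  norm_num [weight, potential]

/-- The potential is convex along the segment from `(R, C)` to `(R', C + 1)`, because
`(a, b) ↦ a ^ 2 / b` is jointly convex. The hypothesis `hR` excludes the junk value of the
potential at `C = 0 < R`. -/
theorem potential_segment_le {R R' C s : ℝ} (hC : 0 ≤ C) (hR : R ≤ C) (hs0 : 0 ≤ s) (hs1 : s ≤ 1) :
    potential ((1 - s) * R + s * R') (C + s) ≤
      (1 - s) * potential R C + s * potential R' (C + 1) := by
  have hexp := convexOn_exp.2 (Set.mem_univ ((max 0 R) ^ 2 / (3 * C)))
    (Set.mem_univ ((max 0 R') ^ 2 / (3 * (C + 1)))) (sub_nonneg.2 hs1) hs0 (by ring)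
  simp only [smul_eq_mul] at hexp
  refine le_trans (Real.exp_le_exp.2 ?_) hexp
  set p := max 0 R with hp
  set q := max 0 R' with hq
  have hp0 : 0 ≤ p := le_max_left _ _
  have hq0 : 0 ≤ q := le_max_left _ _
  have hpq : max 0 ((1 - s) * R + s * R') ≤ (1 - s) * p + s * q := by
    have h1 : R ≤ p := le_max_right _ _
    have h2 : R' ≤ q := le_max_right _ _
    have h3 : 0 ≤ 1 - s := by linarith
    exact max_le (by positivity) (by gcongr)
  have hpos : 0 ≤ max 0 ((1 - s) * R + s * R') := le_max_left _ _
  have hstep : (max 0 ((1 - s) * R + s * R')) ^ 2 / (3 * (C + s)) ≤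
      ((1 - s) * p + s * q) ^ 2 / (3 * (C + s)) := by gcongr
  refine hstep.trans ?_
  rcases hC.eq_or_lt with rfl | hC
  · have hp0 : p = 0 := by simp [hp, hR]
    rcases hs0.eq_or_lt with rfl | hs
    · simp [hp0]
    · rw [hp0]
      apply le_of_eq
      field_simp
      ring
  · rw [div_le_iff₀ (by positivity)]
    have hid : ((1 - s) * (p ^ 2 / (3 * C)) + s * (q ^ 2 / (3 * (C + 1)))) * (3 * (C + s)) -
        ((1 - s) * p + s * q) ^ 2 =
        s * (1 - s) * (p * (C + 1) - q * C) ^ 2 / (C * (C + 1)) := by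
      field_simp
      ring
    have h3 : 0 ≤ 1 - s := by linarith
    have : 0 ≤ s * (1 - s) * (p * (C + 1) - q * C) ^ 2 / (C * (C + 1)) := by positivity
    linarith

/-- A fair coin flip of the regret raises the potential on average by at most a constant. For
`R ^ 2 ≥ 3 (C + 1)` the growth of the denominator compensates for the second-order term of the
exponential; otherwise all exponents are at most `2`. -/
theorem potential_mean_le {R C : ℝ} (hC : 0 ≤ C) (hR : R ≤ C) :
    (potential (R + 1) (C + 1) + potential (R - 1) (C + 1)) / 2 ≤ potential R C + 8 := by
  wlog h0 : 0 ≤ R generalizing R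
  · have h := this hC le_rfl
    have h1 := potential_mono (R := R + 1) (R' := 0 + 1) (C := C + 1) (by linarith) (by linarith)
    have h2 := potential_mono (R := R - 1) (R' := 0 - 1) (C := C + 1) (by linarith) (by linarith)
    simp only [zero_add, zero_sub] at h h1 h2
    have h3 : potential R C = potential 0 C := by
      simp [potential, max_eq_left (not_le.1 h0).le]
    linarith
  set n := C + 1 with hn
  have hn1 : 1 ≤ n := by linarith
  have hplus : potential (R + 1) n = Real.exp ((R ^ 2 + 1) / (3 * n) + 2 * R / (3 * n)) := by
    unfold potential
    rw [max_eq_right (by linarith)]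
    congr 1
    ring
  have hminus : potential (R - 1) n ≤ Real.exp ((R ^ 2 + 1) / (3 * n) + -(2 * R / (3 * n))) := by
    have hsq : (max 0 (R - 1)) ^ 2 ≤ (R - 1) ^ 2 := by
      rcases le_total 0 (R - 1) with h | h
      · rw [max_eq_right h]
      · rw [max_eq_left h, zero_pow two_ne_zero]
        exact sq_nonneg _
    unfold potential
    rw [Real.exp_le_exp]
    calc (max 0 (R - 1)) ^ 2 / (3 * n) ≤ (R - 1) ^ 2 / (3 * n) := by gcongr
      _ = _ := by ring
  have hcosh : (potential (R + 1) n + potential (R - 1) n) / 2 ≤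
      Real.exp ((R ^ 2 + 1) / (3 * n) + 2 * R ^ 2 / (9 * n ^ 2)) := by
    have h1 := Real.cosh_le_exp_half_sq (2 * R / (3 * n))
    rw [Real.cosh_eq] at h1
    have h2 : (2 * R / (3 * n)) ^ 2 / 2 = 2 * R ^ 2 / (9 * n ^ 2) := by field_simp; norm_num
    rw [h2] at h1
    rw [hplus, Real.exp_add]
    rw [Real.exp_add] at hminus
    rw [Real.exp_add]
    have h3 := mul_le_mul_of_nonneg_left h1 (Real.exp_pos ((R ^ 2 + 1) / (3 * n))).le
    linarith
  rcases le_total (3 * n) (R ^ 2) with h | h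
  · have hC0 : 0 < C := by
      rcases hC.eq_or_lt with rfl | h'
      · nlinarith
      · exact h'
    have : Real.exp ((R ^ 2 + 1) / (3 * n) + 2 * R ^ 2 / (9 * n ^ 2)) ≤ potential R C := by
      unfold potential
      rw [max_eq_right h0, Real.exp_le_exp, div_add_div _ _ (by positivity) (by positivity),
        div_le_div_iff₀ (by positivity) (by positivity)]
      have hCn : C = n - 1 := by linarith
      rw [hCn]
      have hn0 : 0 < n := by linarith
      have : 0 ≤ n * ((R ^ 2 - 3 * n) * (n - 1) + 3 * R ^ 2) := by
        have : 0 ≤ (R ^ 2 - 3 * n) * (n - 1) := mul_nonneg (by linarith) (by linarith)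
        positivity
      nlinarith
    linarith
  · have : Real.exp ((R ^ 2 + 1) / (3 * n) + 2 * R ^ 2 / (9 * n ^ 2)) ≤ 8 := by
      have hexp : (R ^ 2 + 1) / (3 * n) + 2 * R ^ 2 / (9 * n ^ 2) ≤ 2 := by
        rw [div_add_div _ _ (by positivity) (by positivity), div_le_iff₀ (by positivity)]
        have hn0 : 0 < n := by linarith
        have h1 : 9 * n ^ 2 * R ^ 2 ≤ 9 * n ^ 2 * (3 * n) := by gcongr
        have h2 : 6 * n * R ^ 2 ≤ 6 * n * (3 * n) := by gcongr
        have h3 : 9 * n ^ 2 ≤ 9 * n ^ 2 * n := by nlinarith [sq_nonneg n]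
        nlinarith
      have he : Real.exp 2 ≤ 8 := by
        have h1 := Real.exp_one_lt_d9
        have h2 : Real.exp 2 = Real.exp 1 * Real.exp 1 := by rw [← Real.exp_add]; norm_num
        rw [h2]
        nlinarith [Real.exp_pos 1]
      exact (Real.exp_le_exp.2 hexp).trans he
    linarith [potential_pos R C]

/-- One round changes the potential by at most the weight times the instantaneous regret, up to an
additive constant. -/
theorem potential_step_le {R C r : ℝ} (hC : 0 ≤ C) (hR : R ≤ C) (hr : |r| ≤ 1) :
    potential (R + r) (C + |r|) ≤ potential R C + weight R C * r + 8 := by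
  have hmean := potential_mean_le hC hR
  have hs := abs_nonneg r
  have hscaled := mul_le_mul_of_nonneg_left hmean hs
  unfold weight
  rcases le_total 0 r with h | h
  · have hseg := potential_segment_le (R' := R + 1) hC hR hs hr
    rw [abs_of_nonneg h] at *
    rw [show (1 - r) * R + r * (R + 1) = R + r by ring] at hseg
    linarith
  · have hseg := potential_segment_le (R' := R - 1) hC hR hs hr
    rw [abs_of_nonpos h] at *
    rw [show (1 - -r) * R + -r * (R - 1) = R + r by ring] at hseg
    linarith

/-! ### Dyadic decomposition of intervals of rounds -/

section Dyadic

variable {F h : ℕ → ℝ} {N : ℕ}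

/-- If the bounds `h k` on the sums over the geometric covering intervals of length `2 ^ k` grow at
least by the factor `4 / 3`, then the sum over at most `2 ^ k` rounds whose first one is a multiple
of `2 ^ k` is at most `4 * h k`: split off a whole interval at the left end and go on with half the
length. -/
theorem sum_le_of_dvd_left (hpos : ∀ k, 0 ≤ h k) (hgrow : ∀ k, 4 / 3 * h k ≤ h (k + 1))
    (hF : ∀ k i, 1 ≤ i → i * 2 ^ k + 2 ^ k ≤ N →
      ∑ t ∈ Finset.Ico (i * 2 ^ k) (i * 2 ^ k + 2 ^ k), F t ≤ h k)
    (k : ℕ) : ∀ i n : ℕ, 1 ≤ i → n ≤ 2 ^ k → i * 2 ^ k + n ≤ N →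
      ∑ t ∈ Finset.Ico (i * 2 ^ k) (i * 2 ^ k + n), F t ≤ 4 * h k := by
  induction k with
  | zero =>
    intro i n hi hn hN
    have h0 := hpos 0
    obtain rfl | rfl : n = 0 ∨ n = 1 := by omega
    · simpa using h0
    · exact (hF 0 i hi hN).trans (by linarith)
  | succ k ih =>
    intro i n hi hn hN
    have hg := hgrow k
    have h0 := hpos k
    have hpow : 2 ^ (k + 1) = 2 ^ k + 2 ^ k := by ring
    have hs : i * 2 ^ (k + 1) = (2 * i) * 2 ^ k := by ring
    have hs' : (2 * i) * 2 ^ k + 2 ^ k = (2 * i + 1) * 2 ^ k := by ring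
    rw [hs] at hN ⊢
    rcases le_total n (2 ^ k) with hnk | hnk
    · exact (ih _ n (by omega) hnk hN).trans (by linarith)
    · rw [← Finset.sum_Ico_consecutive F (Nat.le_add_right _ (2 ^ k)) (by omega)]
      have h1 := hF k (2 * i) (by omega) (by omega)
      have h2 := ih (2 * i + 1) (n - 2 ^ k) (by omega) (by omega) (by omega)
      rw [← hs', show 2 * i * 2 ^ k + 2 ^ k + (n - 2 ^ k) = 2 * i * 2 ^ k + n by omega] at h2
      linarith

/-- The mirror image of `sum_le_of_dvd_left`, for rounds that end just before a multiple of
`2 ^ k`. -/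
theorem sum_le_of_dvd_right (hpos : ∀ k, 0 ≤ h k) (hgrow : ∀ k, 4 / 3 * h k ≤ h (k + 1))
    (hF : ∀ k i, 1 ≤ i → i * 2 ^ k + 2 ^ k ≤ N →
      ∑ t ∈ Finset.Ico (i * 2 ^ k) (i * 2 ^ k + 2 ^ k), F t ≤ h k)
    (k : ℕ) : ∀ s n i : ℕ, 1 ≤ s → n ≤ 2 ^ k → s + n = i * 2 ^ k → s + n ≤ N →
      ∑ t ∈ Finset.Ico s (s + n), F t ≤ 4 * h k := by
  induction k with
  | zero =>
    intro s n i hs hn hi hN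
    have h0 := hpos 0
    obtain rfl | rfl : n = 0 ∨ n = 1 := by omega
    · simpa using h0
    · have := hF 0 s hs (by simpa using hN)
      rw [pow_zero, mul_one] at this
      linarith
  | succ k ih =>
    intro s n i hs hn hi hN
    have hg := hgrow k
    have h0 := hpos k
    have hpow : 2 ^ (k + 1) = 2 ^ k + 2 ^ k := by ring
    have hi' : i * 2 ^ (k + 1) = (2 * i) * 2 ^ k := by ring
    rcases le_total n (2 ^ k) with hnk | hnk
    · exact (ih s n (2 * i) hs hnk (hi.trans hi') hN).trans (by linarith)
    · obtain ⟨j, hj⟩ : ∃ j, 2 * i = j + 2 :=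
        ⟨2 * i - 2, by rcases Nat.eq_zero_or_pos i with rfl | h <;> omega⟩
      have hj' : (j + 2) * 2 ^ k = (j + 1) * 2 ^ k + 2 ^ k := by ring
      rw [hj] at hi'
      rw [← Finset.sum_Ico_consecutive F (show s ≤ (j + 1) * 2 ^ k by omega) (by omega)]
      have h1 := hF k (j + 1) (by omega) (by omega)
      have h2 := ih s ((j + 1) * 2 ^ k - s) (j + 1) hs (by omega) (by omega) (by omega)
      rw [show s + ((j + 1) * 2 ^ k - s) = (j + 1) * 2 ^ k by omega] at h2
      rw [show s + n = (j + 1) * 2 ^ k + 2 ^ k by omega]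
      linarith

/-- Arbitrary intervals: cut at the first multiple `m` of `2 ^ k`, where `2 ^ k` is the largest
power of two up to the length `n`. There are fewer than `2 ^ k` rounds before `m`, and fewer than
`2 * 2 ^ k` after it. -/
theorem sum_Ico_le_of_dyadic (hpos : ∀ k, 0 ≤ h k) (hgrow : ∀ k, 4 / 3 * h k ≤ h (k + 1))
    (hF : ∀ k i, 1 ≤ i → i * 2 ^ k + 2 ^ k ≤ N →
      ∑ t ∈ Finset.Ico (i * 2 ^ k) (i * 2 ^ k + 2 ^ k), F t ≤ h k)
    {s n : ℕ} (hs : 1 ≤ s) (hn : 1 ≤ n) (hN : s + n ≤ N) :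
    ∑ t ∈ Finset.Ico s (s + n), F t ≤ 9 * h (Nat.log 2 n) := by
  set k := Nat.log 2 n with hk
  have hk1 : 2 ^ k ≤ n := Nat.pow_log_le_self 2 (by omega)
  have hk2 : n < 2 ^ k + 2 ^ k := by
    have : n < 2 ^ (k + 1) := Nat.lt_pow_succ_log_self one_lt_two n
    rw [pow_succ] at this
    omega
  have hpow : 0 < 2 ^ k := by positivity
  obtain ⟨i, hi1, hi2⟩ : ∃ i, s ≤ i * 2 ^ k ∧ i * 2 ^ k < s + 2 ^ k := by
    have h1 := Nat.div_add_mod' (s + (2 ^ k - 1)) (2 ^ k)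
    have h2 := Nat.mod_lt (s + (2 ^ k - 1)) hpow
    exact ⟨(s + (2 ^ k - 1)) / 2 ^ k, by omega, by omega⟩
  have hi : 1 ≤ i := by
    rcases Nat.eq_zero_or_pos i with rfl | h
    · omega
    · exact h
  have h0 := hpos k
  have hleft := sum_le_of_dvd_right hpos hgrow hF k s (i * 2 ^ k - s) i hs (by omega) (by omega)
    (by omega)
  rw [show s + (i * 2 ^ k - s) = i * 2 ^ k by omega] at hleft
  have hright : ∑ t ∈ Finset.Ico (i * 2 ^ k) (s + n), F t ≤ 5 * h k := by
    rcases le_total (s + n) (i * 2 ^ k + 2 ^ k) with hle | hle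
    · have := sum_le_of_dvd_left hpos hgrow hF k i (s + n - i * 2 ^ k) hi (by omega) (by omega)
      rw [show i * 2 ^ k + (s + n - i * 2 ^ k) = s + n by omega] at this
      linarith
    · rw [← Finset.sum_Ico_consecutive F (Nat.le_add_right _ (2 ^ k)) hle]
      have h1 := hF k i hi (by omega)
      have hs' : i * 2 ^ k + 2 ^ k = (i + 1) * 2 ^ k := by ring
      have h2 := sum_le_of_dvd_left hpos hgrow hF k (i + 1) (s + n - (i + 1) * 2 ^ k) (by omega)
        (by omega) (by omega)
      rw [show (i + 1) * 2 ^ k + (s + n - (i + 1) * 2 ^ k) = s + n by omega, ← hs'] at h2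
      linarith
  rw [← Finset.sum_Ico_consecutive F hi1 (by omega)]
  linarith

end Dyadic

/-! ### Regret against the experts -/

theorem GCInterval.last_add_one (I : GCInterval) : I.last + 1 = I.start + 2 ^ I.k := by
  have h : 0 < 2 ^ I.k := by positivity
  simp only [last, start, Nat.add_mul, one_mul]
  omega

theorem GCInterval.one_le_start (I : GCInterval) : 1 ≤ I.start :=
  Nat.mul_pos I.one_le_i (by positivity)

theorem mem_active_iff {t : ℕ} {I : GCInterval} :
    I ∈ active t ↔ I.start ≤ t ∧ t < I.start + 2 ^ I.k := by
  rw [mem_active, GCInterval.rounds, Finset.mem_Icc, ← I.last_add_one, Nat.lt_add_one_iff]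

/-- For each length there is at most one active interval, and the lengths are powers of two up to
`t`. -/
theorem card_active_le (t : ℕ) : (active t).card ≤ t := by
  have hinj : Set.InjOn GCInterval.k (active t : Set GCInterval) := by
    rintro ⟨k, i, hi⟩ hI ⟨k', i', hi'⟩ hI' (rfl : k = k')
    rw [Finset.mem_coe, mem_active_iff] at hI hI'
    simp only [GCInterval.start] at hI hI'
    have h1 : t / 2 ^ k = i := Nat.div_eq_of_lt_le hI.1 (by rw [Nat.add_mul]; omega)
    have h2 : t / 2 ^ k = i' := Nat.div_eq_of_lt_le hI'.1 (by rw [Nat.add_mul]; omega)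
    obtain rfl : i = i' := h1.symm.trans h2
    rfl
  rw [← Finset.card_image_of_injOn hinj]
  refine (Finset.card_le_card (t := Finset.range t) ?_).trans (Finset.card_range t).le
  intro k hk
  obtain ⟨I, hI, rfl⟩ := Finset.mem_image.1 hk
  rw [mem_active_iff] at hI
  rw [Finset.mem_range]
  calc I.k < 2 ^ I.k := Nat.lt_two_pow_self
    _ ≤ I.start := Nat.le_mul_of_pos_left _ I.one_le_i
    _ ≤ t := hI.1

section Meta

variable {d : ℕ} {f : ℕ → EuclideanSpace ℝ (Fin d) → ℝ} {x : ℕ → EuclideanSpace ℝ (Fin d)}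
  {xE : ℕ → GCInterval → EuclideanSpace ℝ (Fin d)}

theorem cumAbsRegret_nonneg (t : ℕ) (I : GCInterval) : 0 ≤ cumAbsRegret f x xE t I :=
  Finset.sum_nonneg fun _ _ => abs_nonneg _

theorem cumRegret_le_cumAbsRegret (t : ℕ) (I : GCInterval) :
    cumRegret f x xE t I ≤ cumAbsRegret f x xE t I :=
  Finset.sum_le_sum fun _ _ => le_abs_self _

theorem cumRegret_start (I : GCInterval) : cumRegret f x xE I.start I = 0 := by simp [cumRegret]

theorem cumAbsRegret_start (I : GCInterval) : cumAbsRegret f x xE I.start I = 0 := by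
  simp [cumAbsRegret]

theorem cumRegret_succ {t : ℕ} {I : GCInterval} (h : I.start ≤ t) :
    cumRegret f x xE (t + 1) I = cumRegret f x xE t I + (f t (x t) - f t (xE t I)) :=
  Finset.sum_Ico_succ_top h _

theorem cumAbsRegret_succ {t : ℕ} {I : GCInterval} (h : I.start ≤ t) :
    cumAbsRegret f x xE (t + 1) I = cumAbsRegret f x xE t I + |f t (x t) - f t (xE t I)| :=
  Finset.sum_Ico_succ_top h _

/-- The interval `[t, t]` starts in round `t` and has positive weight, so that the normalization of
the weights never divides by zero. -/
theorem sum_weight_pos {t : ℕ} (ht : 1 ≤ t) :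
    0 < ∑ J ∈ active t, weight (cumRegret f x xE t J) (cumAbsRegret f x xE t J) := by
  set J : GCInterval := ⟨0, t, ht⟩
  have hJt : J.start = t := by simp [J, GCInterval.start]
  refine Finset.sum_pos' (fun I _ => weight_nonneg (cumAbsRegret_nonneg t I))
    ⟨J, mem_active_iff.2 ⟨hJt.le, by simp [hJt, J]⟩, ?_⟩
  have h1 : cumRegret f x xE t J = 0 := by
    conv_lhs => rw [← hJt]
    exact cumRegret_start J
  have h2 : cumAbsRegret f x xE t J = 0 := by
    conv_lhs => rw [← hJt]
    exact cumAbsRegret_start J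
  rw [h1, h2]
  exact weight_zero_zero_pos

theorem sum_expertWeight {t : ℕ} (ht : 1 ≤ t) : ∑ I ∈ active t, expertWeight f x xE t I = 1 := by
  unfold expertWeight
  rw [← Finset.sum_div]
  exact div_self (sum_weight_pos ht).ne'

theorem expertWeight_nonneg (t : ℕ) (I : GCInterval) : 0 ≤ expertWeight f x xE t I :=
  div_nonneg (weight_nonneg (cumAbsRegret_nonneg t I))
    (Finset.sum_nonneg fun J _ => weight_nonneg (cumAbsRegret_nonneg t J))

/-- The weighted average of the instantaneous regrets is at most `0`, by the first-order inequality
at the combined action. -/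
theorem sum_weight_mul_regret_nonpos {t : ℕ} (ht : 1 ≤ t) {v : EuclideanSpace ℝ (Fin d)}
    (hx : x t = ∑ I ∈ active t, expertWeight f x xE t I • xE t I)
    (hv : ∀ I ∈ active t, f t (x t) + inner ℝ v (xE t I - x t) ≤ f t (xE t I)) :
    ∑ I ∈ active t, weight (cumRegret f x xE t I) (cumAbsRegret f x xE t I) *
      (f t (x t) - f t (xE t I)) ≤ 0 := by
  set w : GCInterval → ℝ := fun I => weight (cumRegret f x xE t I) (cumAbsRegret f x xE t I)
    with hw
  set W := ∑ J ∈ active t, w J with hW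
  have hWpos : 0 < W := sum_weight_pos ht
  have hzero : ∑ I ∈ active t, w I • (xE t I - x t) = 0 := by
    have hWx : W • x t = ∑ I ∈ active t, w I • xE t I := by
      rw [hx, Finset.smul_sum]
      refine Finset.sum_congr rfl fun I _ => ?_
      rw [smul_smul]
      congr 1
      exact mul_div_cancel₀ _ hWpos.ne'
    simp only [smul_sub, Finset.sum_sub_distrib]
    rw [← hWx, ← Finset.sum_smul, sub_self]
  calc ∑ I ∈ active t, w I * (f t (x t) - f t (xE t I))
      ≤ ∑ I ∈ active t, -inner ℝ v (w I • (xE t I - x t)) := by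
        refine Finset.sum_le_sum fun I hI => ?_
        rw [inner_smul_right, ← mul_neg]
        exact mul_le_mul_of_nonneg_left (by linarith [hv I hI])
          (weight_nonneg (cumAbsRegret_nonneg t I))
    _ = 0 := by rw [Finset.sum_neg_distrib, ← inner_sum, hzero, inner_zero_right, neg_zero]

/-- The total potential of the active experts after round `t`. In each round it increases by at most
`8` per active expert, and by `1` for each expert that starts; experts that stop only lower it. -/
theorem sum_potential_le {T : ℕ}
    (hr : ∀ t ∈ Finset.Icc 1 T, ∀ I ∈ active t, |f t (x t) - f t (xE t I)| ≤ 1)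
    (hw : ∀ t ∈ Finset.Icc 1 T,
      ∑ I ∈ active t, weight (cumRegret f x xE t I) (cumAbsRegret f x xE t I) *
        (f t (x t) - f t (xE t I)) ≤ 0) :
    ∀ t ≤ T, ∑ I ∈ active t, potential (cumRegret f x xE (t + 1) I) (cumAbsRegret f x xE (t + 1) I)
      ≤ 9 * (t : ℝ) ^ 2 := by
  intro t
  induction t with
  | zero =>
    intro _
    have h0 : active 0 = ∅ := Finset.card_eq_zero.1 (Nat.le_zero.1 (card_active_le 0))
    simp [h0]
  | succ t ih =>
    intro hT
    have ht : t + 1 ∈ Finset.Icc 1 T := Finset.mem_Icc.2 ⟨by omega, hT⟩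
    set Φ : GCInterval → ℝ := fun I =>
      potential (cumRegret f x xE (t + 1) I) (cumAbsRegret f x xE (t + 1) I) with hΦ
    have hcard : ((active (t + 1)).card : ℝ) ≤ t + 1 := by exact_mod_cast card_active_le (t + 1)
    have hold : ∑ I ∈ active (t + 1), Φ I ≤ ∑ I ∈ active t, Φ I + (active (t + 1)).card := by
      classical
      rw [← Finset.sum_filter_add_sum_filter_not (active (t + 1)) (fun I => I ∈ active t)]
      gcongr ?_ + ?_
      · exact Finset.sum_le_sum_of_subset_of_nonneg
          (fun I hI => (Finset.mem_filter.1 hI).2) fun I _ _ => (potential_pos _ _).le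
      · calc ∑ I ∈ active (t + 1) with I ∉ active t, Φ I
            = ∑ I ∈ active (t + 1) with I ∉ active t, (1 : ℝ) := by
              refine Finset.sum_congr rfl fun I hI => ?_
              rw [Finset.mem_filter, mem_active_iff, mem_active_iff] at hI
              have hs : t + 1 = I.start := by omega
              simp only [hΦ, hs, cumRegret_start, cumAbsRegret_start]
              simp [potential]
          _ ≤ (active (t + 1)).card := by
              rw [Finset.sum_const, nsmul_eq_mul, mul_one]
              exact_mod_cast Finset.card_filter_le _ _
    have hstep : ∑ I ∈ active (t + 1),
        potential (cumRegret f x xE (t + 1 + 1) I) (cumAbsRegret f x xE (t + 1 + 1) I) ≤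
        ∑ I ∈ active (t + 1), (Φ I +
          weight (cumRegret f x xE (t + 1) I) (cumAbsRegret f x xE (t + 1) I) *
            (f (t + 1) (x (t + 1)) - f (t + 1) (xE (t + 1) I)) + 8) := by
      refine Finset.sum_le_sum fun I hI => ?_
      rw [cumRegret_succ (mem_active_iff.1 hI).1, cumAbsRegret_succ (mem_active_iff.1 hI).1]
      exact potential_step_le (cumAbsRegret_nonneg _ _) (cumRegret_le_cumAbsRegret _ _)
        (hr _ ht I hI)
    rw [Finset.sum_add_distrib, Finset.sum_add_distrib, Finset.sum_const, nsmul_eq_mul] at hstep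
    have h1 := ih (by omega)
    have h2 := hw _ ht
    push_cast
    nlinarith [Nat.cast_nonneg (α := ℝ) t]

/-- The regret against an expert at the end of its interval. The total potential is polynomial in `T`,
and the potential of a single expert is exponential in its squared regret over the length. -/
theorem cumRegret_le {T : ℕ}
    (hr : ∀ t ∈ Finset.Icc 1 T, ∀ I ∈ active t, |f t (x t) - f t (xE t I)| ≤ 1)
    (hw : ∀ t ∈ Finset.Icc 1 T,
      ∑ I ∈ active t, weight (cumRegret f x xE t I) (cumAbsRegret f x xE t I) *
        (f t (x t) - f t (xE t I)) ≤ 0)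
    {I : GCInterval} (hI : I.start + 2 ^ I.k ≤ T + 1) :
    cumRegret f x xE (I.start + 2 ^ I.k) I ≤ Real.sqrt (3 * 2 ^ I.k * (3 + 2 * Real.log T)) := by
  have hlast := I.last_add_one
  have hstart := I.one_le_start
  have hpow : 0 < 2 ^ I.k := by positivity
  have hT : 1 ≤ T := by omega
  have hTpos : (0 : ℝ) < T := by exact_mod_cast hT
  have hl : 0 ≤ Real.log T := Real.log_natCast_nonneg T
  rw [← hlast]
  set C := cumAbsRegret f x xE (I.last + 1) I with hC
  set ρ := cumRegret f x xE (I.last + 1) I with hρ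
  have hmem : I ∈ active I.last := mem_active_iff.2 ⟨by omega, by omega⟩
  have hpot : potential ρ C ≤ 9 * (T : ℝ) ^ 2 := by
    refine (Finset.single_le_sum (f := fun J => potential (cumRegret f x xE (I.last + 1) J)
      (cumAbsRegret f x xE (I.last + 1) J)) (fun J _ => (potential_pos _ _).le) hmem).trans
      ((sum_potential_le hr hw I.last (by omega)).trans ?_)
    have : (I.last : ℝ) ≤ T := by exact_mod_cast (by omega : I.last ≤ T)
    gcongr
  have hCL : C ≤ 2 ^ I.k := by
    calc C ≤ ∑ u ∈ Finset.Ico I.start (I.last + 1), (1 : ℝ) := by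
          refine Finset.sum_le_sum fun u hu => ?_
          rw [Finset.mem_Ico] at hu
          exact hr u (Finset.mem_Icc.2 ⟨by omega, by omega⟩) I (mem_active_iff.2 ⟨hu.1, by omega⟩)
      _ = 2 ^ I.k := by
          rw [Finset.sum_const, Nat.card_Ico, nsmul_eq_mul, mul_one, hlast,
            Nat.add_sub_cancel_left]
          norm_num
  rcases le_or_gt ρ 0 with h | h
  · exact h.trans (Real.sqrt_nonneg _)
  · have hCpos : 0 < C := h.trans_le (cumRegret_le_cumAbsRegret _ _)
    refine Real.le_sqrt_of_sq_le ?_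
    have hexp : ρ ^ 2 / (3 * C) ≤ Real.log (9 * (T : ℝ) ^ 2) := by
      rw [Real.le_log_iff_exp_le (by positivity)]
      rwa [potential, max_eq_right h.le] at hpot
    have hlog : Real.log (9 * (T : ℝ) ^ 2) ≤ 3 + 2 * Real.log T := by
      rw [Real.log_mul (by norm_num) (by positivity), Real.log_pow]
      have : Real.log 9 ≤ 3 := by
        rw [Real.log_le_iff_le_exp (by norm_num)]
        have h1 := Real.exp_one_gt_d9
        have h2 : Real.exp 3 = Real.exp 1 ^ 3 := by rw [← Real.exp_nat_mul]; norm_num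
        rw [h2]
        calc (9 : ℝ) ≤ 2.7182818283 ^ 3 := by norm_num
          _ ≤ _ := by gcongr
      push_cast
      linarith
    have h3 := hexp.trans hlog
    rw [div_le_iff₀ (by positivity)] at h3
    have h4 : (3 + 2 * Real.log T) * (3 * C) ≤ (3 + 2 * Real.log T) * (3 * 2 ^ I.k) := by gcongr
    linarith

end Meta

/-! ### Strongly adaptive regret -/

theorem saRegret_le {d : ℕ} {K : Set (EuclideanSpace ℝ (Fin d))} (hK : K.Nonempty)
    {f : ℕ → EuclideanSpace ℝ (Fin d) → ℝ} {x : ℕ → EuclideanSpace ℝ (Fin d)} {T τ : ℕ}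
    (hτ : τ ≤ T) {b : ℝ}
    (h : ∀ s, 1 ≤ s → s + τ ≤ T + 1 → ∀ u ∈ K, ∑ t ∈ Finset.Ico s (s + τ), (f t (x t) - f t u) ≤ b) :
    saRegret K f x T τ ≤ b := by
  refine csSup_le ⟨_, 1, le_rfl, by omega, rfl⟩ ?_
  rintro r ⟨s, hs, hsT, rfl⟩
  rw [staticRegret, sub_le_comm]
  refine le_csInf (hK.image _) ?_
  rintro _ ⟨u, hu, rfl⟩
  have := h s hs hsT u hu
  rw [Finset.sum_sub_distrib] at this
  linarith

/-- The regret of the expert of `I` over the whole interval: step size `|I| ^ (-3/4)` and block size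
of order `|I| ^ (1/2)` balance all terms at `|I| ^ (3/4)`. -/
theorem expert_regret_le {d : ℕ} {K : Set (EuclideanSpace ℝ (Fin d))}
    {O : ℝ → EuclideanSpace ℝ (Fin d) → EuclideanSpace ℝ (Fin d) →
      EuclideanSpace ℝ (Fin d) × EuclideanSpace ℝ (Fin d)}
    {g : ℕ → EuclideanSpace ℝ (Fin d) → EuclideanSpace ℝ (Fin d)}
    {f : ℕ → EuclideanSpace ℝ (Fin d) → ℝ} {z : ℕ → EuclideanSpace ℝ (Fin d)} {R Γ : ℝ} {B : ℕ}
    {I : GCInterval} (hO : IsInfeasibleProjectionOracle K R O)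
    (hKR : K ⊆ Metric.closedBall 0 R) (hΓ : 0 ≤ Γ)
    (hg : ∀ t, I.start ≤ t → t ≤ I.last → ∀ p ∈ K, ‖g t p‖ ≤ Γ)
    (hconv : ∀ t, I.start ≤ t → t ≤ I.last → ∀ p ∈ K, ∀ q ∈ K,
      f t p + inner ℝ (g t p) (q - p) ≤ f t q)
    (hf : ∀ t, I.start ≤ t → t ≤ I.last → ∀ p ∈ K, 0 ≤ f t p ∧ f t p ≤ 1)
    (hB : IsBlockSize ((I.length : ℝ) ^ (-(3 / 4) : ℝ)) B)
    (h : IsBOGDRun K O g ((I.length : ℝ) ^ (-(3 / 4) : ℝ)) B I.start I.last z)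
    {u : EuclideanSpace ℝ (Fin d)} (hu : u ∈ K) :
    ∑ t ∈ Finset.Ico I.start (I.start + 2 ^ I.k), (f t (z t) - f t u) ≤
      (2 * R ^ 2 + Γ ^ 2 + 2 * Γ + 2) * ((2 : ℝ) ^ I.k) ^ (3 / 4 : ℝ) := by
  have hlen : (I.length : ℝ) = 2 ^ I.k := by rw [I.length_eq]; norm_num
  have hL1 : (1 : ℝ) ≤ 2 ^ I.k := one_le_pow₀ one_le_two
  rw [hlen] at hB h
  set L : ℝ := 2 ^ I.k with hL
  have hL0 : 0 < L := by linarith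
  -- All powers that occur are integral powers of the fourth root of the length.
  set q : ℝ := L ^ (1 / 4 : ℝ) with hq
  have hq1 : 1 ≤ q := Real.one_le_rpow hL1 (by norm_num)
  have hq0 : 0 < q := by linarith
  have hqn : ∀ n : ℕ, q ^ n = L ^ ((1 / 4 : ℝ) * n) := fun n => by
    rw [hq, ← Real.rpow_natCast, ← Real.rpow_mul hL0.le]
  have e4 : L = q ^ 4 := by rw [hqn]; norm_num
  have e3 : L ^ (3 / 4 : ℝ) = q ^ 3 := by rw [hqn]; norm_num
  have eη : L ^ (-(3 / 4) : ℝ) = (q ^ 3)⁻¹ := by rw [Real.rpow_neg hL0.le, e3]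
  have eB : (L ^ (-(3 / 4) : ℝ)) ^ (-(2 / 3) : ℝ) = q ^ 2 := by
    rw [hqn, ← Real.rpow_mul hL0.le]; norm_num
  have eε : (L ^ (-(3 / 4) : ℝ)) ^ (2 / 3 : ℝ) = (q ^ 2)⁻¹ := by
    rw [hqn, ← Real.rpow_mul hL0.le, ← Real.rpow_neg hL0.le]; norm_num
  obtain ⟨hB1, hB2⟩ := hB.bounds hq1 eB
  have hreg := h.regret_le (f := f) hO (by positivity) hB1 hKR hΓ hg hconv hf
    I.last_add_one.symm hu
  refine hreg.trans ?_
  have hcast : ((2 ^ I.k : ℕ) : ℝ) = q ^ 4 := by rw [← e4, hL]; norm_num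
  rw [eε, eη, e3, hcast]
  have hsqrt : Real.sqrt (3 * (q ^ 2)⁻¹) ≤ 2 * q⁻¹ := by
    rw [Real.sqrt_le_left (by positivity), mul_pow, inv_pow]
    gcongr
    norm_num
  have h1 : (2 * R) ^ 2 / (2 * (q ^ 3)⁻¹) = 2 * R ^ 2 * q ^ 3 := by field_simp
  have h2 : q ^ 4 * ((q ^ 3)⁻¹ * B * Γ ^ 2 / 2 + Γ * Real.sqrt (3 * (q ^ 2)⁻¹)) ≤
      q ^ 4 * ((q ^ 3)⁻¹ * (2 * q ^ 2) * Γ ^ 2 / 2 + Γ * (2 * q⁻¹)) := by gcongr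
  have h3 : q ^ 4 * ((q ^ 3)⁻¹ * (2 * q ^ 2) * Γ ^ 2 / 2 + Γ * (2 * q⁻¹)) =
      Γ ^ 2 * q ^ 3 + 2 * Γ * q ^ 3 := by field_simp
  have h4 : q ^ 2 ≤ q ^ 3 := pow_le_pow_right₀ hq1 (by norm_num)
  linarith

/-- Without the logarithm, the regret against an expert is dominated by the regret of the expert
itself. -/
theorem sqrt_meta_bound_le {L l : ℝ} (hL : 1 ≤ L) (hl : 0 ≤ l) :
    Real.sqrt (3 * L * (3 + 2 * l)) ≤ 3 * (Real.sqrt (L * l) + L ^ (3 / 4 : ℝ)) := by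
  have hL0 : 0 ≤ L := by linarith
  have hsq : Real.sqrt (L * l) ^ 2 = L * l := Real.sq_sqrt (by positivity)
  have hpow : L ≤ (L ^ (3 / 4 : ℝ)) ^ 2 := by
    rw [← Real.rpow_natCast, ← Real.rpow_mul hL0]
    exact Real.self_le_rpow_of_one_le hL (by norm_num)
  have h1 := Real.sqrt_nonneg (L * l)
  have h2 : 0 ≤ L ^ (3 / 4 : ℝ) := by positivity
  rw [Real.sqrt_le_left (by positivity)]
  nlinarith [mul_nonneg h1 h2, mul_nonneg hL0 hl]

end POLA

open POLA in
theorem theorem3 (R G : ℝ) :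
    ∃ c : ℝ, ∀ (d : ℕ) (K : Set (EuclideanSpace ℝ (Fin d)))
      (O : ℝ → EuclideanSpace ℝ (Fin d) → EuclideanSpace ℝ (Fin d) →
        EuclideanSpace ℝ (Fin d) × EuclideanSpace ℝ (Fin d))
      (T : ℕ) (f : ℕ → EuclideanSpace ℝ (Fin d) → ℝ)
      (g : ℕ → EuclideanSpace ℝ (Fin d) → EuclideanSpace ℝ (Fin d))
      (xE : ℕ → POLA.GCInterval → EuclideanSpace ℝ (Fin d))
      (x : ℕ → EuclideanSpace ℝ (Fin d)),
      Convex ℝ K →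
      0 ∈ K →
      K ⊆ Metric.closedBall 0 R →
      (∀ t ∈ Finset.Icc 1 T, ∀ u ∈ K, ∀ v ∈ K, |f t u - f t v| ≤ G * ‖u - v‖) →
      (∀ t ∈ Finset.Icc 1 T, ∀ u ∈ K, POLA.IsLossGradient K G (f t) u (g t u)) →
      (∀ t ∈ Finset.Icc 1 T, ∀ u ∈ K, ∀ v ∈ K, f t v ≥ f t u + inner ℝ (g t u) (v - u)) →
      (∀ t ∈ Finset.Icc 1 T, ∀ u ∈ K, 0 ≤ f t u ∧ f t u ≤ 1) →
      POLA.IsInfeasibleProjectionOracle K R O →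
      POLA.IsPOLARun K O T f g xE x →
      ∀ τ : ℕ, 1 ≤ τ → τ ≤ T →
        POLA.saRegret K f x T τ
            ≤ c * (Real.sqrt (τ * Real.log T) + (τ : ℝ) ^ (3 / 4 : ℝ)) ∧
        POLA.saRegret K f x T τ
            ≤ c * (Real.sqrt (1 + Real.log T) * (τ : ℝ) ^ (3 / 4 : ℝ)) := by
  -- `A - 3` bounds the regret of the experts, and `3` that of the meta algorithm; the factor `18` is
  -- `9` from the dyadic decomposition times `2` from adding up the two summands.
  set A : ℝ := 2 * R ^ 2 + |G| ^ 2 + 2 * |G| + 5 with hA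
  have hA0 : 0 ≤ A := by positivity
  refine ⟨18 * A, ?_⟩
  intro d K O T f g xE x hK h0 hKR hLip hgrad hconv hf hO hrun τ hτ1 hτT
  have hτ0 : (1 : ℝ) ≤ τ := by exact_mod_cast hτ1
  set l := Real.log T with hl_def
  have hl : 0 ≤ l := Real.log_natCast_nonneg T
  have hIcc : ∀ {t : ℕ}, 1 ≤ t → t ≤ T → t ∈ Finset.Icc 1 T := fun h1 h2 =>
    Finset.mem_Icc.2 ⟨h1, h2⟩
  have hxE : ∀ t ∈ Finset.Icc 1 T, ∀ I ∈ active t, xE t I ∈ K := by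
    intro t ht I hI
    rw [Finset.mem_Icc] at ht
    rw [mem_active_iff, ← I.last_add_one] at hI
    obtain ⟨B, -, hE⟩ := hrun.expert I (by omega)
    have hlen : (0 : ℝ) < I.length := by rw [I.length_eq]; positivity
    exact hE.mem hO (by positivity) hI.1 (le_min (by omega) ht.2)
  have hxK : ∀ t ∈ Finset.Icc 1 T, x t ∈ K := by
    intro t ht
    rw [hrun.combine t ht]
    exact hK.sum_mem (fun I _ => expertWeight_nonneg t I)
      (sum_expertWeight (Finset.mem_Icc.1 ht).1) (hxE t ht)
  have hr : ∀ t ∈ Finset.Icc 1 T, ∀ I ∈ active t, |f t (x t) - f t (xE t I)| ≤ 1 := by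
    intro t ht I hI
    have h1 := hf t ht _ (hxK t ht)
    have h2 := hf t ht _ (hxE t ht I hI)
    exact abs_le.2 ⟨by linarith, by linarith⟩
  have hw : ∀ t ∈ Finset.Icc 1 T,
      ∑ I ∈ active t, weight (cumRegret f x xE t I) (cumAbsRegret f x xE t I) *
        (f t (x t) - f t (xE t I)) ≤ 0 := fun t ht =>
    sum_weight_mul_regret_nonpos (Finset.mem_Icc.1 ht).1 (hrun.combine t ht) fun I hI =>
      hconv t ht _ (hxK t ht) _ (hxE t ht I hI)
  set h : ℕ → ℝ := fun k => A * (Real.sqrt (2 ^ k * l) + ((2 : ℝ) ^ k) ^ (3 / 4 : ℝ)) with hh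
  have hpos : ∀ k, 0 ≤ h k := fun k => by positivity
  have hgrow : ∀ k, 4 / 3 * h k ≤ h (k + 1) := by
    intro k
    have h2 : (4 / 3 : ℝ) ≤ Real.sqrt 2 := Real.le_sqrt_of_sq_le (by norm_num)
    have h3 : Real.sqrt 2 ≤ 2 ^ (3 / 4 : ℝ) := by
      rw [Real.sqrt_eq_rpow]
      exact Real.rpow_le_rpow_of_exponent_le one_le_two (by norm_num)
    have e1 : Real.sqrt (2 ^ (k + 1) * l) = Real.sqrt 2 * Real.sqrt (2 ^ k * l) := by
      rw [← Real.sqrt_mul zero_le_two]; congr 1; ring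
    have e2 : ((2 : ℝ) ^ (k + 1)) ^ (3 / 4 : ℝ) = 2 ^ (3 / 4 : ℝ) * ((2 : ℝ) ^ k) ^ (3 / 4 : ℝ) := by
      rw [← Real.mul_rpow (by positivity) (by positivity)]; congr 1; ring
    have h4 : (4 / 3 : ℝ) ≤ 2 ^ (3 / 4 : ℝ) := h2.trans h3
    calc 4 / 3 * h k =
          A * (4 / 3 * Real.sqrt (2 ^ k * l) + 4 / 3 * ((2 : ℝ) ^ k) ^ (3 / 4 : ℝ)) := by
          simp only [hh]; ring
      _ ≤ A * (Real.sqrt 2 * Real.sqrt (2 ^ k * l) +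
            2 ^ (3 / 4 : ℝ) * ((2 : ℝ) ^ k) ^ (3 / 4 : ℝ)) := by gcongr
      _ = h (k + 1) := by simp only [hh, e1, e2]
  have hinterval : ∀ u ∈ K, ∀ k i, 1 ≤ i → i * 2 ^ k + 2 ^ k ≤ T + 1 →
      ∑ t ∈ Finset.Ico (i * 2 ^ k) (i * 2 ^ k + 2 ^ k), (f t (x t) - f t u) ≤ h k := by
    intro u hu k i hi hT
    set I : GCInterval := ⟨k, i, hi⟩ with hI
    change ∑ t ∈ Finset.Ico I.start (I.start + 2 ^ I.k), (f t (x t) - f t u) ≤ h k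
    have hIT : I.start + 2 ^ I.k ≤ T + 1 := hT
    have hlast := I.last_add_one
    have hstart := I.one_le_start
    have hp : 0 < 2 ^ I.k := by positivity
    obtain ⟨B, hB, hE⟩ := hrun.expert I (by omega)
    rw [min_eq_left (by omega)] at hE
    have hexp := expert_regret_le (f := f) (Γ := |G|) hO hKR (abs_nonneg G)
      (fun t h1 h2 p hp => (hgrad t (hIcc (by omega) (by omega)) p hp).norm_le hK h0 hp
        (hLip t (hIcc (by omega) (by omega))))
      (fun t h1 h2 p hp q hq => hconv t (hIcc (by omega) (by omega)) p hp q hq)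
      (fun t h1 h2 p hp => hf t (hIcc (by omega) (by omega)) p hp) hB hE hu
    have hmeta := (cumRegret_le hr hw hIT).trans
      (sqrt_meta_bound_le (one_le_pow₀ one_le_two) hl)
    have hsplit : ∑ t ∈ Finset.Ico I.start (I.start + 2 ^ I.k), (f t (x t) - f t u) =
        cumRegret f x xE (I.start + 2 ^ I.k) I +
          ∑ t ∈ Finset.Ico I.start (I.start + 2 ^ I.k), (f t (xE t I) - f t u) := by
      rw [cumRegret, ← Finset.sum_add_distrib]
      exact Finset.sum_congr rfl fun t _ => by ring
    have hS := mul_nonneg (by linarith [abs_nonneg G, sq_nonneg |G|, sq_nonneg R] : 0 ≤ A - 3)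
      (Real.sqrt_nonneg (2 ^ k * l))
    rw [hsplit]
    simp only [hh]
    change _ ≤ A * (Real.sqrt (2 ^ I.k * l) + ((2 : ℝ) ^ I.k) ^ (3 / 4 : ℝ))
    change 0 ≤ (A - 3) * Real.sqrt (2 ^ I.k * l) at hS
    rw [hA] at hS ⊢
    linarith
  have hlog : h (Nat.log 2 τ) ≤ A * (Real.sqrt (τ * l) + (τ : ℝ) ^ (3 / 4 : ℝ)) := by
    have : (2 : ℝ) ^ Nat.log 2 τ ≤ τ := by exact_mod_cast Nat.pow_log_le_self 2 (by omega)
    simp only [hh]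
    gcongr
  have hmain : saRegret K f x T τ ≤ 9 * (A * (Real.sqrt (τ * l) + (τ : ℝ) ^ (3 / 4 : ℝ))) := by
    refine saRegret_le ⟨0, h0⟩ hτT fun s hs hsT u hu => ?_
    have := sum_Ico_le_of_dyadic hpos hgrow (hinterval u hu) hs hτ1 hsT
    linarith
  have hS : 0 ≤ A * (Real.sqrt (τ * l) + (τ : ℝ) ^ (3 / 4 : ℝ)) := by positivity
  refine ⟨by linarith, ?_⟩
  have hτpow : (0 : ℝ) ≤ (τ : ℝ) ^ (3 / 4 : ℝ) := by positivity
  have h1 : Real.sqrt (τ * l) ≤ Real.sqrt (1 + l) * (τ : ℝ) ^ (3 / 4 : ℝ) := by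
    rw [Real.sqrt_mul (by positivity), mul_comm, Real.sqrt_eq_rpow τ]
    exact mul_le_mul (Real.sqrt_le_sqrt (by linarith))
      (Real.rpow_le_rpow_of_exponent_le hτ0 (by norm_num)) (by positivity) (by positivity)
  have h2 : (τ : ℝ) ^ (3 / 4 : ℝ) ≤ Real.sqrt (1 + l) * (τ : ℝ) ^ (3 / 4 : ℝ) :=
    le_mul_of_one_le_left hτpow (Real.one_le_sqrt.2 (by linarith))
  have h3 := mul_le_mul_of_nonneg_left (add_le_add h1 h2) hA0
  linarith
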